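/- Let $G$ be a topological group, equipped with its right uniformity (the uniformity generated by all continuous right-invariant pseudometrics; a base of entourages is given by $\{(x,y): yx^{-1}\in V\}$, $V$ a neighbourhood of the identity). Let $U_b(G)$ be the space of bounded uniformly continuous functions $f:G\to\mathbb R$ with the supremum norm, and let $M(G)$ be its norm dual, with the dual norm $\|\cdot\|$. For a uniformly continuous pseudometric $d$ on $G$ put $$\mathrm{Lip}(d)=\{f:G\to\mathbb R \;:\; |f(x)|\le 1 \text{ and } |f(x)-f(y)|\le d(x,y)\text{ for all }x,y\in G\},$$ a subset of $U_b(G)$, which is given the topology of pointwise convergence. Let - $M_u(G)$ be the set of uniform measures, i.e. of those $\mu\in M(G)$ whose restriction to $\mathrm{Lip}(d)$ is continuous for every uniformly continuous pseudometric $d$ on $G$; - $M^+(G)$ be the set of those $\mu\in M(G)$ such that $\mu(f)\ge 0$ whenever $f\ge 0$; and $M_u^+(G)=M_u(G)\cap M^+(G)$. The weak* topology on $M(G)$ is the weak topology of the duality $\langle M(G),U_b(G)\rangle$; the UEB topology on $M(G)$ is the topology of uniform convergence on the sets $\mathrm{Lip}(d)$, $d$ ranging over all uniformly continuous pseudometrics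 on $G$. For $\mu,\nu\in M(G)$ the convolution $\mu\star\nu\in M(G)$ is defined by $$(\mu\star\nu)(f)=\mu\bigl(x\mapsto\nu(y\mapsto f(xy))\bigr),\qquad f\in U_b(G).$$ **Theorem.** 1. $\|\mu\star\nu\|\le\|\mu\|\,\|\nu\|$ for all $\mu,\nu\in M(G)$. 2. Let $B\subseteq M(G)$ be bounded in norm, $\mu_0\in M_u(G)$ and $\nu_0\in B$. When $M(G)$ and its subset $B$ carry their UEB topologies, the map $(\mu,\nu)\mapsto\mu\star\nu$ from $M(G)\times B$ to $M(G)$ is jointly continuous at $(\mu_0,\nu_0)$. 3. The map $(\mu,\nu)\mapsto\mu\star\nu$ takes $M_u(G)\times M_u(G)$ into $M_u(G)$, and it is jointly sequentially continuous for the weak* topology on $M_u(G)$. 4. The map $(\mu,\nu)\mapsto\mu\star\nu$ takes $M^+(G)\times M^+(G)$ into $M^+(G)$; when $M^+(G)$ carries the weak* topology, this map is jointly continuous at $(\mu_0,\nu_0)$ for all $\mu_0\in M_u^+(G)$ and $\nu_0\in M^+(G)$. 5. If $\mu\in M_u(G)$, then the map $\nu\mapsto\mu\star\nu$ from $M(G)$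 to itself is weak* continuous. -/

import Mathlib

open Filter Topology Set Uniformity BoundedContinuousFunction

noncomputable section

namespace UnifMeas

/-- The bounded uniformly continuous real functions on a uniform space `X`, as a linear subspace
of the bounded continuous functions. -/
def UbSubmodule (X : Type*) [UniformSpace X] : Submodule ℝ (X →ᵇ ℝ) where
  carrier := {f | UniformContinuous f}
  add_mem' := fun hf hg => UniformContinuous.add hf hg
  zero_mem' := uniformContinuous_const
  smul_mem' := fun c _ hf => UniformContinuous.const_smul hf c

/-- The space `U_b(X)` of bounded uniformly continuous real functions on `X`,
with the supremum norm inherited from `X →ᵇ ℝ`. -/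
def Ub (X : Type*) [UniformSpace X] : Type _ := UbSubmodule X

instance (X : Type*) [UniformSpace X] : NormedAddCommGroup (Ub X) :=
  inferInstanceAs (NormedAddCommGroup (UbSubmodule X))

instance (X : Type*) [UniformSpace X] : NormedSpace ℝ (Ub X) :=
  inferInstanceAs (NormedSpace ℝ (UbSubmodule X))

/-- The space `M(X)`, the norm dual of `U_b(X)`, with the dual norm. -/
abbrev Meas (X : Type*) [UniformSpace X] : Type _ := StrongDual ℝ (Ub X)

/-- `d` is a uniformly continuous pseudometric on `X`. -/
structure IsUCP {X : Type*} [UniformSpace X] (d : X → X → ℝ) : Prop where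
  nonneg : ∀ x y, 0 ≤ d x y
  self : ∀ x, d x x = 0
  symm : ∀ x y, d x y = d y x
  triangle : ∀ x y z, d x z ≤ d x y + d y z
  unif : ∀ ε : ℝ, 0 < ε → ∀ᶠ p in 𝓤 X, d p.1 p.2 < ε

/-- `Lip(d)`: the functions bounded by `1` in absolute value and `1`-Lipschitz for `d`
(if `d` is a uniformly continuous pseudometric, all such functions lie in `U_b(X)`). -/
def Lip {X : Type*} [UniformSpace X] (d : X → X → ℝ) : Set (Ub X) :=
  {f | (∀ x, |f.1 x| ≤ 1) ∧ ∀ x y, |f.1 x - f.1 y| ≤ d x y}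

/-- The topology of pointwise convergence on `Lip(d)`, as a subset of the product space `ℝ^X`. -/
abbrev pointwiseTopology {X : Type*} [UniformSpace X] (d : X → X → ℝ) :
    TopologicalSpace (Lip d) :=
  TopologicalSpace.induced (fun (f : Lip d) (x : X) => f.1.1 x) Pi.topologicalSpace

/-- `M_u(X)`: the uniform measures on `X`, i.e. the functionals that are continuous on `Lip(d)`
with its topology of pointwise convergence, for every uniformly continuous pseudometric `d`. -/
def UMeas (X : Type*) [UniformSpace X] : Set (Meas X) :=
  {μ | ∀ d : X → X → ℝ, IsUCP d →
    @Continuous (Lip d) ℝ (pointwiseTopology d) inferInstance (fun f => μ f.1)}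

/-- `M⁺(X)`: the positive functionals. -/
def MeasPos (X : Type*) [UniformSpace X] : Set (Meas X) :=
  {μ | ∀ f : Ub X, (∀ x, 0 ≤ f.1 x) → 0 ≤ μ f}

/-- The space `M(X)` with the UEB topology: uniform convergence on the sets `Lip(d)`, where `d`
runs through all uniformly continuous pseudometrics on `X`. -/
abbrev MeasUEB (X : Type*) [UniformSpace X] : Type _ :=
  UniformConvergenceCLM (RingHom.id ℝ) ℝ {S : Set (Ub X) | ∃ d, IsUCP d ∧ S = Lip d}

/-- The identity map from `M(X)` to `M(X)` with the UEB topology. -/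
def toUEB {X : Type*} [UniformSpace X] : Meas X ≃ MeasUEB X :=
  UniformConvergenceCLM.ofFun (RingHom.id ℝ) ℝ {S : Set (Ub X) | ∃ d, IsUCP d ∧ S = Lip d}

/-- The space `M(X)` with the weak* topology of the duality with `U_b(X)`. -/
abbrev MeasW (X : Type*) [UniformSpace X] : Type _ := WeakDual ℝ (Ub X)

/-- The identity map from `M(X)` to `M(X)` with the weak* topology. -/
def toW {X : Type*} [UniformSpace X] : Meas X ≃ MeasW X :=
  (StrongDual.toWeakDual (𝕜 := ℝ) (E := Ub X)).toEquiv

section Convolution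

variable {G : Type*} [Group G] [UniformSpace G] [IsRightUniformGroup G]

theorem uniformContinuous_leftMul (x : G) : UniformContinuous (fun y : G => x * y) := by
  have key : Tendsto (fun p : G × G => x * (p.2 * p.1⁻¹) * x⁻¹) (𝓤 G) (𝓝 1) := by
    have h1 : Tendsto (fun p : G × G => p.2 * p.1⁻¹) (𝓤 G) (𝓝 1) := by
      rw [uniformity_eq_comap_mul_inv_nhds_one G]
      exact tendsto_comap
    have h2 : Tendsto (fun z : G => x * z * x⁻¹) (𝓝 1) (𝓝 1) := by
      have h3 : Continuous (fun z : G => x * z * x⁻¹) := by fun_prop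
      simpa using h3.tendsto 1
    exact h2.comp h1
  rw [UniformContinuous]
  conv => rhs; rw [uniformity_eq_comap_mul_inv_nhds_one G]
  rw [tendsto_comap_iff]
  refine key.congr fun p => ?_
  simp [mul_assoc]

/-- For `f ∈ U_b(G)` and `x ∈ G`, the function `y ↦ f (x * y)`, as an element of `U_b(G)`. -/
def ltrans (f : Ub G) (x : G) : Ub G :=
  ⟨f.1.compContinuous ⟨fun y => x * y, (uniformContinuous_leftMul x).continuous⟩,
    UniformContinuous.comp f.2 (uniformContinuous_leftMul x)⟩

@[simp] theorem ltrans_apply (f : Ub G) (x y : G) : (ltrans f x).1 y = f.1 (x * y) := rfl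

theorem norm_ltrans_le (f : Ub G) (x : G) : ‖ltrans f x‖ ≤ ‖f‖ :=
  (BoundedContinuousFunction.norm_le (norm_nonneg f)).2 fun y => f.1.norm_coe_le_norm (x * y)

theorem norm_apply_ltrans_le (ν : Meas G) (f : Ub G) (x : G) :
    ‖ν (ltrans f x)‖ ≤ ‖ν‖ * ‖f‖ :=
  (ν.le_opNorm _).trans (mul_le_mul_of_nonneg_left (norm_ltrans_le f x) (norm_nonneg ν))

theorem uniformContinuous_apply_ltrans (ν : Meas G) (f : Ub G) :
    UniformContinuous (fun x : G => ν (ltrans f x)) := by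
  refine ν.uniformContinuous.comp ?_
  rw [UniformContinuous, Metric.uniformity_basis_dist_le.tendsto_right_iff]
  intro ε hε
  have hf : ∀ᶠ p in 𝓤 G, dist (f.1 p.1) (f.1 p.2) < ε :=
    (Metric.uniformity_basis_dist.tendsto_right_iff.1 (show Tendsto _ _ _ from f.2)) ε hε
  rw [uniformity_eq_comap_mul_inv_nhds_one G, eventually_comap] at hf ⊢
  filter_upwards [hf] with z hz p hp
  show dist (ltrans f p.1).1 (ltrans f p.2).1 ≤ ε
  refine (BoundedContinuousFunction.dist_le hε.le).2 fun y => ?_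
  refine (hz (p.1 * y, p.2 * y) ?_).le
  rw [← hp]
  simp [mul_assoc]

/-- For `f ∈ U_b(G)` and `ν ∈ M(G)`, the function `x ↦ ν (y ↦ f (x * y))` in `U_b(G)`. -/
def slice (ν : Meas G) (f : Ub G) : Ub G :=
  ⟨BoundedContinuousFunction.ofNormedAddCommGroup (fun x => ν (ltrans f x))
    (uniformContinuous_apply_ltrans ν f).continuous (‖ν‖ * ‖f‖) (norm_apply_ltrans_le ν f),
    uniformContinuous_apply_ltrans ν f⟩

@[simp] theorem slice_apply (ν : Meas G) (f : Ub G) (x : G) :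
    (slice ν f).1 x = ν (ltrans f x) := rfl

theorem norm_slice_le (ν : Meas G) (f : Ub G) : ‖slice ν f‖ ≤ ‖ν‖ * ‖f‖ :=
  (BoundedContinuousFunction.norm_le (by positivity)).2 (norm_apply_ltrans_le ν f)

/-- The convolution `μ ⋆ ν (f) = μ (x ↦ ν (y ↦ f (x * y)))`. -/
def conv (μ ν : Meas G) : Meas G :=
  LinearMap.mkContinuous
    { toFun := fun f => μ (slice ν f)
      map_add' := fun f g => by
        have h : slice ν (f + g) = slice ν f + slice ν g :=
          Subtype.ext (BoundedContinuousFunction.ext fun x =>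
            map_add ν (ltrans f x) (ltrans g x))
        rw [h, map_add]
      map_smul' := fun c f => by
        have h : slice ν (c • f) = c • slice ν f :=
          Subtype.ext (BoundedContinuousFunction.ext fun x => map_smul ν c (ltrans f x))
        rw [h, map_smul, RingHom.id_apply] }
    (‖μ‖ * ‖ν‖) fun f => by
      rw [mul_assoc]
      exact (μ.le_opNorm _).trans
        (mul_le_mul_of_nonneg_left (norm_slice_le ν f) (norm_nonneg μ))

theorem conv_apply (μ ν : Meas G) (f : Ub G) : conv μ ν f = μ (slice ν f) := rfl

end Convolution

end UnifMeas

end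

open UnifMeas

noncomputable section

/-! By definition `conv μ ν f = μ (slice ν f)`. The central estimate `LipB.slice` says that if `f`
is bounded and Lipschitz for `d`, then the slices of `f` by all `ν` in a norm ball are bounded and
Lipschitz, with one constant, for the single right-invariant pseudometric `rsup d`. Convergence of
`ν` makes the slices converge pointwise, so continuity of convolution reduces to `μ (g) → 0` along
pointwise null, equi-Lipschitz nets `g`.

This holds for a fixed uniform `μ` by definition (`UMeas.tendsto`), and UEB convergence `μ → μ₀`
controls the remaining term uniformly. For positive `μ` converging weak* it holds by domination
(`MeasPos.tendsto_zero`), and for sequences of uniform measures by Baire category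
(`tendsto_zero_of_lipB`).

Weak* continuity in the right factor is a Fubini identity: `conv μ ν f` is `ν` evaluated at `fiber
hμ f`. It is immediate for combinations of point masses, and passes to all `ν` by norm-bounded weak*
density. -/

namespace UnifMeas

/-! ### Scaled Lipschitz bounds. -/

section LipB

variable {X : Type*}

/-- `f` is bounded by `C` in absolute value and `C`-Lipschitz for `d`. -/
def LipB (d : X → X → ℝ) (C : ℝ) (f : X → ℝ) : Prop :=
  (∀ x, |f x| ≤ C) ∧ ∀ x y, |f x - f y| ≤ C * d x y

theorem LipB.sub {d : X → X → ℝ} {C C' : ℝ} {f g : X → ℝ} (hf : LipB d C f)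
    (hg : LipB d C' g) : LipB d (C + C') (fun x => f x - g x) := by
  refine ⟨fun x => (abs_sub _ _).trans (add_le_add (hf.1 x) (hg.1 x)), fun x y => ?_⟩
  have h : f x - g x - (f y - g y) = (f x - f y) - (g x - g y) := by ring
  rw [h, add_mul]
  exact (abs_sub _ _).trans (add_le_add (hf.2 x y) (hg.2 x y))

theorem LipB.const_mul {d : X → X → ℝ} {C c : ℝ} (hc : 0 ≤ c) {f : X → ℝ} (hf : LipB d C f) :
    LipB d (c * C) (fun x => c * f x) := by
  refine ⟨fun x => ?_, fun x y => ?_⟩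
  · rw [abs_mul, abs_of_nonneg hc]
    exact mul_le_mul_of_nonneg_left (hf.1 x) hc
  · rw [← mul_sub, abs_mul, abs_of_nonneg hc, mul_assoc]
    exact mul_le_mul_of_nonneg_left (hf.2 x y) hc

end LipB

/-! ### The space `Ub X`, uniform measures and the two topologies. -/

section General

variable {X : Type*} [UniformSpace X]

theorem Ub.ext {f g : Ub X} (h : ∀ x, f.1 x = g.1 x) : f = g :=
  Subtype.ext (BoundedContinuousFunction.ext h)

@[simp] theorem Ub.add_apply (f g : Ub X) (x : X) : (f + g).1 x = f.1 x + g.1 x := rfl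

@[simp] theorem Ub.sub_apply (f g : Ub X) (x : X) : (f - g).1 x = f.1 x - g.1 x := rfl

@[simp] theorem Ub.zero_apply (x : X) : (0 : Ub X).1 x = 0 := rfl

@[simp] theorem Ub.smul_apply (c : ℝ) (f : Ub X) (x : X) : (c • f).1 x = c * f.1 x := rfl

theorem Ub.abs_apply_le (f : Ub X) (x : X) : |f.1 x| ≤ ‖f‖ := f.1.norm_coe_le_norm x

theorem Ub.norm_le {f : Ub X} {C : ℝ} (hC : 0 ≤ C) (h : ∀ x, |f.1 x| ≤ C) : ‖f‖ ≤ C :=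
  (BoundedContinuousFunction.norm_le hC).2 h

/-- A bounded uniformly continuous function, as an element of `U_b(X)`. -/
def Ub.mk (f : X → ℝ) (C : ℝ) (hb : ∀ x, |f x| ≤ C) (hu : UniformContinuous f) : Ub X :=
  ⟨BoundedContinuousFunction.ofNormedAddCommGroup f hu.continuous C hb, hu⟩

/-- Uniform limits preserve uniform continuity. Completeness is what Banach–Steinhaus needs. -/
instance : CompleteSpace (Ub X) := by
  have h : IsClosed (UbSubmodule X : Set (X →ᵇ ℝ)) := by
    refine isClosed_of_closure_subset fun f hf => ?_
    have hne : (𝓝[(UbSubmodule X : Set (X →ᵇ ℝ))] f).NeBot := mem_closure_iff_nhdsWithin_neBot.1 hf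
    have ht : Tendsto (fun g : X →ᵇ ℝ => g) (𝓝[(UbSubmodule X : Set (X →ᵇ ℝ))] f) (𝓝 f) :=
      tendsto_id.mono_left nhdsWithin_le_nhds
    have hu : ∀ᶠ g : X →ᵇ ℝ in 𝓝[(UbSubmodule X : Set (X →ᵇ ℝ))] f, UniformContinuous g :=
      eventually_mem_nhdsWithin
    exact (BoundedContinuousFunction.tendsto_iff_tendstoUniformly.1 ht).uniformContinuous
      hu.frequently
  exact h.completeSpace_coe

theorem mem_Lip_iff {d : X → X → ℝ} {f : Ub X} : f ∈ Lip d ↔ LipB d 1 (fun x => f.1 x) := by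
  simp [Lip, LipB]

theorem IsUCP.const_mul {d : X → X → ℝ} (hd : IsUCP d) {C : ℝ} (hC : 0 ≤ C) :
    IsUCP fun x y => C * d x y where
  nonneg x y := mul_nonneg hC (hd.nonneg x y)
  self x := by simp [hd.self]
  symm x y := by rw [hd.symm]
  triangle x y z := by rw [← mul_add]; exact mul_le_mul_of_nonneg_left (hd.triangle x y z) hC
  unif ε hε := by
    filter_upwards [hd.unif (ε / (C + 1)) (by positivity)] with p hp
    rw [lt_div_iff₀ (by positivity)] at hp
    nlinarith [hd.nonneg p.1 p.2]

theorem IsUCP.uniformContinuous {d : X → X → ℝ} (hd : IsUCP d) {f : X → ℝ}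
    (hf : ∀ x y, |f x - f y| ≤ d x y) : UniformContinuous f := by
  rw [UniformContinuous, Metric.uniformity_basis_dist.tendsto_right_iff]
  intro ε hε
  filter_upwards [hd.unif ε hε] with p hp
  exact (hf p.1 p.2).trans_lt hp

theorem LipB.mono {d : X → X → ℝ} (hd : IsUCP d) {C C' : ℝ} (hC : C ≤ C') {f : X → ℝ}
    (hf : LipB d C f) : LipB d C' f :=
  ⟨fun x => (hf.1 x).trans hC, fun x y =>
    (hf.2 x y).trans (mul_le_mul_of_nonneg_right hC (hd.nonneg x y))⟩

/-- Scaling by `C + 1` rather than `C` covers the case `C = 0`. -/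
theorem LipB.inv_smul_mem {d : X → X → ℝ} (hd : IsUCP d) {C : ℝ} (hC : 0 ≤ C) {f : Ub X}
    (hf : LipB d C (fun x => f.1 x)) : (C + 1)⁻¹ • f ∈ Lip d := by
  have h : LipB d 1 (fun x => (C + 1)⁻¹ * f.1 x) := by
    have := (hf.mono hd (le_add_of_nonneg_right zero_le_one)).const_mul
      (c := (C + 1)⁻¹) (by positivity)
    rwa [inv_mul_cancel₀ (by positivity)] at this
  exact mem_Lip_iff.2 h

theorem Ub.exists_lipB (f : Ub X) : ∃ d C, IsUCP d ∧ 0 ≤ C ∧ LipB d C (fun x => f.1 x) := by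
  refine ⟨fun x y => |f.1 x - f.1 y|, ‖f‖ + 1, ⟨fun _ _ => abs_nonneg _, by simp,
    fun _ _ => abs_sub_comm _ _, fun _ _ _ => abs_sub_le _ _ _, fun ε hε => ?_⟩, by positivity,
    fun x => (f.abs_apply_le x).trans (by simp), fun x y => ?_⟩
  · exact (Metric.uniformity_basis_dist.tendsto_right_iff.1
      (show Tendsto _ _ _ from f.2)) ε hε
  · exact le_mul_of_one_le_left (abs_nonneg _) (by simp)

/-- Uniform measures respect pointwise convergence of nets that are bounded and equi-Lipschitz
for a uniformly continuous pseudometric. -/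
theorem UMeas.tendsto {μ : Meas X} (hμ : μ ∈ UMeas X) {d : X → X → ℝ} (hd : IsUCP d)
    {C : ℝ} (hC : 0 ≤ C) {ι : Type*} {l : Filter ι} {g : ι → Ub X} {g₀ : Ub X}
    (hg : ∀ᶠ i in l, LipB d C (fun x => (g i).1 x)) (hg₀ : LipB d C (fun x => g₀.1 x))
    (h : ∀ x, Tendsto (fun i => (g i).1 x) l (𝓝 (g₀.1 x))) :
    Tendsto (fun i => μ (g i)) l (𝓝 (μ g₀)) := by
  classical
  let _ := pointwiseTopology d
  have hcont : Continuous (fun f : Lip d => μ f.1) := hμ d hd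
  have hpos : 0 < C + 1 := by positivity
  let G₀ : Lip d := ⟨(C + 1)⁻¹ • g₀, hg₀.inv_smul_mem hd hC⟩
  -- The Lipschitz bound holds only eventually; the other indices receive the default `G₀`, which
  -- does not affect the limit.
  let G : ι → Lip d := fun i => if hi : LipB d C (fun x => (g i).1 x) then
    ⟨(C + 1)⁻¹ • g i, hi.inv_smul_mem hd hC⟩ else G₀
  have hG : ∀ᶠ i in l, (G i).1 = (C + 1)⁻¹ • g i := by
    filter_upwards [hg] with i hi
    simp only [G, dif_pos hi]
  have hlim : Tendsto G l (𝓝 G₀) := by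
    rw [nhds_induced, tendsto_comap_iff, tendsto_pi_nhds]
    intro x
    refine ((h x).const_mul (C + 1)⁻¹).congr' ?_
    filter_upwards [hG] with i hi
    simp only [Function.comp_apply]
    rw [hi]; rfl
  have h2 := ((hcont.tendsto G₀).comp hlim).const_mul (C + 1)
  have h3 : (C + 1) * μ G₀.1 = μ g₀ := by
    simp only [G₀, map_smul, smul_eq_mul]
    field_simp
  rw [h3] at h2
  refine h2.congr' ?_
  filter_upwards [hG] with i hi
  simp only [Function.comp_apply, hi, map_smul, smul_eq_mul]
  field_simp

theorem mem_UMeas_of_tendsto {μ : Meas X}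
    (h : ∀ d, IsUCP d → ∀ (l : Filter (Lip d)) (f₀ : Lip d),
      (∀ x, Tendsto (fun f : Lip d => f.1.1 x) l (𝓝 (f₀.1.1 x))) →
      Tendsto (fun f : Lip d => μ f.1) l (𝓝 (μ f₀.1))) : μ ∈ UMeas X := by
  intro d hd
  let _ := pointwiseTopology d
  refine continuous_iff_continuousAt.2 fun f₀ => h d hd _ f₀ fun x => ?_
  have : Continuous (fun f : Lip d => fun x => f.1.1 x) := continuous_induced_dom
  exact ((continuous_apply x).comp this).tendsto f₀

theorem UMeas.sub_mem {μ ν : Meas X} (hμ : μ ∈ UMeas X) (hν : ν ∈ UMeas X) : μ - ν ∈ UMeas X :=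
  fun d hd => by
    let _ := pointwiseTopology d
    exact (hμ d hd).sub (hν d hd)

theorem tendsto_toW_iff {ι : Type*} {l : Filter ι} {μ : ι → MeasW X} {μ₀ : MeasW X} :
    Tendsto μ l (𝓝 μ₀) ↔
      ∀ f : Ub X, Tendsto (fun i => toW.symm (μ i) f) l (𝓝 (toW.symm μ₀ f)) :=
  tendsto_iff_forall_eval_tendsto_topDualPairing

/-- The factor `𝓟 (Lip d)` encodes uniformity in the test function, so that pairs of a functional
and a test function form one net. -/
theorem tendsto_toUEB_iff {ι : Type*} {l : Filter ι} {μ : ι → MeasUEB X} {μ₀ : MeasUEB X} :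
    Tendsto μ l (𝓝 μ₀) ↔ ∀ d, IsUCP d →
      Tendsto (fun q : ι × Ub X => (toUEB.symm (μ q.1) - toUEB.symm μ₀) q.2)
        (l ×ˢ 𝓟 (Lip d)) (𝓝 0) := by
  rw [UniformConvergenceCLM.tendsto_iff_tendstoUniformlyOn]
  have key : ∀ d : X → X → ℝ, TendstoUniformlyOn (fun i (f : Ub X) => μ i f) μ₀ l (Lip d) ↔
      Tendsto (fun q : ι × Ub X => (toUEB.symm (μ q.1) - toUEB.symm μ₀) q.2)
        (l ×ˢ 𝓟 (Lip d)) (𝓝 0) := fun d => by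
    rw [tendstoUniformlyOn_iff_tendsto, uniformity_eq_comap_nhds_zero, tendsto_comap_iff]
    rfl
  constructor
  · intro h d hd
    exact (key d).1 (h _ ⟨d, hd, rfl⟩)
  · rintro h _ ⟨d, hd, rfl⟩
    exact (key d).2 (h d hd)

theorem tendsto_toUEB_lipB {ι : Type*} {l : Filter ι} {μ : ι → MeasUEB X} {μ₀ : MeasUEB X}
    (h : Tendsto μ l (𝓝 μ₀)) {d : X → X → ℝ} (hd : IsUCP d) {C : ℝ} (hC : 0 ≤ C)
    {κ : Type*} {m : Filter κ} {i : κ → ι} (hi : Tendsto i m l) {g : κ → Ub X}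
    (hg : ∀ᶠ k in m, LipB d C (fun x => (g k).1 x)) :
    Tendsto (fun k => (toUEB.symm (μ (i k)) - toUEB.symm μ₀) (g k)) m (𝓝 0) := by
  have h1 : Tendsto (fun k => (i k, (C + 1)⁻¹ • g k)) m (l ×ˢ 𝓟 (Lip d)) := by
    refine hi.prodMk (tendsto_principal.2 ?_)
    filter_upwards [hg] with k hk using hk.inv_smul_mem hd hC
  have h2 := ((tendsto_toUEB_iff.1 h d hd).comp h1).const_mul (C + 1)
  rw [mul_zero] at h2
  refine h2.congr fun k => ?_
  have : C + 1 ≠ 0 := by positivity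
  simp only [Function.comp_apply, map_smul, smul_eq_mul]
  field_simp

end General

theorem abs_sup'_sub_sup'_le {ι : Type*} {F : Finset ι} (hF : F.Nonempty) {a b : ι → ℝ} {c : ℝ}
    (h : ∀ i ∈ F, |a i - b i| ≤ c) : |F.sup' hF a - F.sup' hF b| ≤ c := by
  rw [abs_sub_le_iff, sub_le_iff_le_add, sub_le_iff_le_add]
  constructor <;> refine Finset.sup'_le _ _ fun i hi => ?_
  · have := Finset.le_sup' b hi
    linarith [(abs_sub_le_iff.1 (h i hi)).1]
  · have := Finset.le_sup' a hi
    linarith [(abs_sub_le_iff.1 (h i hi)).2]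

theorem abs_inf'_sub_inf'_le {ι : Type*} {F : Finset ι} (hF : F.Nonempty) {a b : ι → ℝ} {c : ℝ}
    (h : ∀ i ∈ F, |a i - b i| ≤ c) : |F.inf' hF a - F.inf' hF b| ≤ c := by
  rw [abs_sub_le_iff, sub_le_comm, sub_le_comm (b := F.inf' hF a)]
  constructor <;> refine Finset.le_inf' _ _ fun i hi => ?_
  · have := Finset.inf'_le a hi
    linarith [(abs_sub_le_iff.1 (h i hi)).1]
  · have := Finset.inf'_le b hi
    linarith [(abs_sub_le_iff.1 (h i hi)).2]

/-! ### Positive functionals: weak* convergence to a uniform measure. -/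

section Positive

variable {X : Type*} [UniformSpace X]

/-- The constant function `1` in `U_b(X)`. -/
def Ub.one : Ub X := Ub.mk (fun _ => 1) 1 (by simp) uniformContinuous_const

@[simp] theorem Ub.one_apply (x : X) : (Ub.one : Ub X).1 x = 1 := rfl

theorem MeasPos.abs_apply_le {μ : Meas X} (hμ : μ ∈ MeasPos X) {g h : Ub X}
    (hgh : ∀ x, |g.1 x| ≤ h.1 x) : |μ g| ≤ μ h := by
  have h1 := hμ (h - g) fun x => by
    rw [Ub.sub_apply]; linarith [(abs_le.1 (hgh x)).2]
  have h2 := hμ (h + g) fun x => by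
    rw [Ub.add_apply]; linarith [(abs_le.1 (hgh x)).1]
  rw [map_sub] at h1
  rw [map_add] at h2
  exact abs_le.2 ⟨by linarith, by linarith⟩

theorem MeasPos.norm_le {μ : Meas X} (hμ : μ ∈ MeasPos X) : ‖μ‖ ≤ μ Ub.one := by
  refine μ.opNorm_le_bound (hμ _ fun x => by simp) fun f => ?_
  have := MeasPos.abs_apply_le hμ (g := f) (h := ‖f‖ • Ub.one) fun x => by
    simpa using f.abs_apply_le x
  rw [map_smul, smul_eq_mul, mul_comm] at this
  exact this

/-- The distance to the finite set `F ∪ {x₀}` with respect to `d`, truncated at `1`. -/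
def truncDist [DecidableEq X] (d : X → X → ℝ) (x₀ : X) (F : Finset X) (y : X) : ℝ :=
  (insert x₀ F).inf' (Finset.insert_nonempty x₀ F) fun x => min 1 (d y x)

variable [DecidableEq X] {d : X → X → ℝ}

theorem truncDist_nonneg (hd : IsUCP d) (x₀ : X) (F : Finset X) (y : X) :
    0 ≤ truncDist d x₀ F y :=
  Finset.le_inf' _ _ fun x _ => le_min zero_le_one (hd.nonneg y x)

theorem lipB_truncDist (hd : IsUCP d) (x₀ : X) (F : Finset X) : LipB d 1 (truncDist d x₀ F) := by
  refine ⟨fun y => ?_, fun y z => abs_inf'_sub_inf'_le _ fun x _ => ?_⟩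
  · rw [abs_of_nonneg (truncDist_nonneg hd x₀ F y)]
    exact (Finset.inf'_le _ (Finset.mem_insert_self x₀ F)).trans (min_le_left _ _)
  · refine (abs_min_sub_min_le_max _ _ _ _).trans ?_
    rw [sub_self, abs_zero, one_mul]
    refine max_le (hd.nonneg y z) (abs_sub_le_iff.2 ⟨?_, ?_⟩)
    · linarith [hd.triangle y z x]
    · linarith [hd.triangle z y x, hd.symm y z]

theorem truncDist_of_mem (hd : IsUCP d) (x₀ : X) {F : Finset X} {y : X} (hy : y ∈ F) :
    truncDist d x₀ F y = 0 := by
  refine le_antisymm ?_ (truncDist_nonneg hd x₀ F y)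
  refine (Finset.inf'_le _ (Finset.mem_insert_of_mem hy)).trans ?_
  rw [hd.self]
  exact min_le_right _ _

/-- For positive functionals, weak* convergence to a uniform measure yields convergence to zero
along pointwise null nets of bounded equi-Lipschitz functions. -/
theorem MeasPos.tendsto_zero (x₀ : X) {ι : Type*} {l : Filter ι} {μ : ι → Meas X}
    {μ₀ : Meas X} (hμ₀ : μ₀ ∈ UMeas X) (hpos : ∀ᶠ i in l, μ i ∈ MeasPos X)
    (hpos₀ : μ₀ ∈ MeasPos X) (hlim : ∀ f, Tendsto (fun i => μ i f) l (𝓝 (μ₀ f)))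
    (hd : IsUCP d) {C : ℝ} {g : ι → Ub X}
    (hg : ∀ᶠ i in l, LipB d C (fun x => (g i).1 x))
    (h : ∀ x, Tendsto (fun i => (g i).1 x) l (𝓝 0)) :
    Tendsto (fun i => μ i (g i)) l (𝓝 0) := by
  rw [Metric.tendsto_nhds]
  intro ε hε
  have hP : ∀ F, LipB d 1 (truncDist d x₀ F) := lipB_truncDist hd x₀
  let P : Finset X → Ub X := fun F => Ub.mk (truncDist d x₀ F) 1 (hP F).1
    ((hd.const_mul zero_le_one).uniformContinuous (hP F).2)
  -- At each point the truncated distance vanishes once `F` contains that point, and `μ₀` is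
  -- uniform.
  have hPlim : Tendsto (fun F => μ₀ (P F)) atTop (𝓝 (μ₀ 0)) := by
    refine UMeas.tendsto hμ₀ hd zero_le_one (Eventually.of_forall hP)
      ⟨by simp, by simpa using hd.nonneg⟩ fun x => ?_
    refine tendsto_const_nhds.congr' ?_
    filter_upwards [eventually_ge_atTop {x}] with F hF
    exact (truncDist_of_mem hd x₀ (hF (Finset.mem_singleton_self x))).symm
  rw [map_zero] at hPlim
  obtain ⟨F, hF⟩ := ((hPlim.const_mul C).eventually_lt_const
    (show C * 0 < ε / 2 by simpa using hε)).exists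
  have hm : 0 ≤ μ₀ Ub.one := hpos₀ _ fun x => by simp
  set η := ε / (2 * (μ₀ Ub.one + 1)) with hη
  have hη0 : 0 < η := by positivity
  have hη1 : η * μ₀ Ub.one ≤ ε / 2 := by
    have : η * (μ₀ Ub.one + 1) = ε / 2 := by rw [hη]; field_simp
    nlinarith
  have hsum : ∀ᶠ i in l, η * μ i Ub.one + C * μ i (P F) < ε :=
    (((hlim _).const_mul η).add ((hlim _).const_mul C)).eventually_lt_const (by linarith)
  have hsmall : ∀ᶠ i in l, ∀ x ∈ insert x₀ F, |(g i).1 x| < η :=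
    (Filter.eventually_all_finset _).2 fun x _ => by
      simpa using (Metric.tendsto_nhds.1 (h x)) η hη0
  filter_upwards [hpos, hg, hsum, hsmall] with i hi hgi hs hsm
  rw [Real.dist_0_eq_abs]
  refine lt_of_le_of_lt ?_ hs
  -- Since `g i` is below `η` on the finite set, it is dominated everywhere by `η + C • P F`: far
  -- from the set by its bound `C`, near it by the Lipschitz condition. Weak* convergence is thus
  -- needed at two fixed functions only.
  have := MeasPos.abs_apply_le hi (g := g i) (h := η • Ub.one + C • P F) fun y => by
    obtain ⟨x, hx, hxy⟩ := Finset.exists_mem_eq_inf' (Finset.insert_nonempty x₀ F)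
      fun x => min 1 (d y x)
    have hval : (η • Ub.one + C • P F).1 y = η + C * min 1 (d y x) := by
      rw [Ub.add_apply, Ub.smul_apply, Ub.smul_apply, Ub.one_apply, mul_one, ← hxy]
      rfl
    rw [hval]
    rcases le_total 1 (d y x) with h1 | h1
    · rw [min_eq_left h1]
      linarith [hgi.1 y]
    · rw [min_eq_right h1]
      have h2 := abs_sub_abs_le_abs_sub ((g i).1 y) ((g i).1 x)
      linarith [hgi.2 y x, hsm x hx]
  simpa using this

end Positive

/-! ### Weak* density of molecular measures with norm control. -/

section Density

variable {X : Type*} [UniformSpace X]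

/-- The point mass at `x`. -/
def dirac (x : X) : Meas X :=
  LinearMap.mkContinuous
    { toFun := fun f => f.1 x
      map_add' := fun _ _ => rfl
      map_smul' := fun _ _ => rfl } 1 fun f => by
    rw [one_mul]; exact f.abs_apply_le x

theorem norm_dirac_le (x : X) : ‖dirac x‖ ≤ 1 :=
  LinearMap.mkContinuous_norm_le _ zero_le_one _

/-- The molecular measures of norm at most `‖ν‖` accumulate at `ν` in the weak* topology. -/
theorem mem_closure_molecular (ν : Meas X) :
    toW ν ∈ closure {ξ : MeasW X |
      toW.symm ξ ∈ Submodule.span ℝ (range (dirac (X := X))) ∧ ‖toW.symm ξ‖ ≤ ‖ν‖} := by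
  set D := {ξ : MeasW X |
      toW.symm ξ ∈ Submodule.span ℝ (range (dirac (X := X))) ∧ ‖toW.symm ξ‖ ≤ ‖ν‖} with hD
  have : LocallyConvexSpace ℝ (MeasW X) :=
    inferInstanceAs (LocallyConvexSpace ℝ (WeakBilin (topDualPairing ℝ (Ub X))))
  have hconv : Convex ℝ D := by
    have h1 : Convex ℝ ((Submodule.span ℝ (range (dirac (X := X))) : Set (Meas X)) ∩
        Metric.closedBall 0 ‖ν‖) := (Submodule.convex _).inter (convex_closedBall _ _)
    have h2 := h1.linear_preimage
      (StrongDual.toWeakDual (𝕜 := ℝ) (E := Ub X)).symm.toLinearMap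
    convert h2 using 1
    ext ξ
    simp only [hD, mem_ofPred_eq, mem_preimage, mem_inter_iff, mem_closedBall_zero_iff]
    rfl
  by_contra hν
  obtain ⟨φ, u, hu, hφ⟩ := geometric_hahn_banach_closed_point hconv.closure isClosed_closure hν
  -- Weak* continuous functionals are evaluations. Testing the separating `h` on `±‖ν‖ • dirac x`
  -- gives `‖ν‖ * ‖h‖ ≤ u`, against `u < ν h`.
  obtain ⟨h, rfl⟩ := LinearMap.dualEmbedding_surjective (topDualPairing ℝ (Ub X)) φ
  have hle : ∀ ξ : Meas X, ξ ∈ Submodule.span ℝ (range (dirac (X := X))) → ‖ξ‖ ≤ ‖ν‖ →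
      ξ h ≤ u := fun ξ h1 h2 => (hu (toW ξ) (subset_closure ⟨h1, h2⟩)).le
  have hlt : u < ν h := hφ
  have hu0 : 0 ≤ u := by simpa using hle 0 (Submodule.zero_mem _) (by simp)
  have hmem : ∀ (c : ℝ) (x : X), |c| ≤ ‖ν‖ → c * h.1 x ≤ u := fun c x hc =>
    hle (c • dirac x) (Submodule.smul_mem _ _ (Submodule.subset_span ⟨x, rfl⟩)) (by
      rw [norm_smul, Real.norm_eq_abs]
      exact (mul_le_of_le_one_right (abs_nonneg c) (norm_dirac_le x)).trans hc)
  have hn : ‖‖ν‖ • h‖ ≤ u := Ub.norm_le hu0 fun x => by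
    rw [Ub.smul_apply, abs_le]
    have h1 := hmem ‖ν‖ x (by simp)
    have h2 := hmem (-‖ν‖) x (by simp)
    constructor <;> linarith
  rw [norm_smul, norm_norm] at hn
  linarith [ν.le_opNorm h, le_abs_self (ν h), Real.norm_eq_abs (ν h)]

end Density

/-! ### Compact sets of Lipschitz functions and hump functions. -/

section LipUnit

variable {X : Type*}

/-- The functions with values in `[0, 1]` that are `1`-Lipschitz for `d`, with the topology of
pointwise convergence. -/
def LipUnit (d : X → X → ℝ) : Set (X → ℝ) :=
  {f | (∀ x, f x ∈ Icc (0 : ℝ) 1) ∧ ∀ x y, |f x - f y| ≤ d x y}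

theorem isCompact_LipUnit (d : X → X → ℝ) : IsCompact (LipUnit d) := by
  refine (isCompact_univ_pi (s := fun _ : X => Icc (0 : ℝ) 1)
    fun _ => isCompact_Icc).of_isClosed_subset ?_ fun f hf x _ => hf.1 x
  simp only [LipUnit, ofPred_and, ofPred_forall]
  exact (isClosed_iInter fun x => isClosed_Icc.preimage (continuous_apply x)).inter
    (isClosed_iInter fun x => isClosed_iInter fun y => isClosed_le (by fun_prop) continuous_const)

theorem LipUnit.lipB {d : X → X → ℝ} {f : X → ℝ} (hf : f ∈ LipUnit d) : LipB d 1 f :=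
  ⟨fun x => abs_le.2 ⟨by linarith [(hf.1 x).1], (hf.1 x).2⟩, by simpa using hf.2⟩

theorem LipUnit.max {d : X → X → ℝ} {f g : X → ℝ} (hf : f ∈ LipUnit d) (hg : g ∈ LipUnit d) :
    (fun x => f x ⊔ g x) ∈ LipUnit d :=
  ⟨fun x => ⟨le_sup_of_le_left (hf.1 x).1, max_le (hf.1 x).2 (hg.1 x).2⟩, fun x y =>
    (abs_max_sub_max_le_max _ _ _ _).trans (max_le (hf.2 x y) (hg.2 x y))⟩

/-- The least nonnegative function that is `1`-Lipschitz for `d` and dominates `f` on `F`. -/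
def hump (d : X → X → ℝ) (f : X → ℝ) (F : Finset X) (hF : F.Nonempty) (y : X) : ℝ :=
  0 ⊔ F.sup' hF fun x => f x - d y x

/-- Steepness `C` confines the positive part of the hump to points within `1 / C` of `F`, where `g`
exceeds `η` by at most `1 / C`. -/
theorem hump_min_le {d : X → X → ℝ} {C : ℝ} (hC : 0 < C) {f : X → ℝ}
    (hf : ∀ x, f x ≤ 1) {F : Finset X} (hF : F.Nonempty) {g : X → ℝ} {η : ℝ} (hη : 0 ≤ η)
    (hg : ∀ x y, |g x - g y| ≤ d x y) (hgF : ∀ x ∈ F, g x ≤ η) (y : X) :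
    hump (fun x y => C * d x y) f F hF y ⊓ g y ≤ η + 1 / C := by
  have hC' : 0 < 1 / C := by positivity
  obtain ⟨x, hx, hxy⟩ := Finset.exists_mem_eq_sup' hF fun x => f x - C * d y x
  rw [hump, hxy]
  rcases le_or_gt (f x - C * d y x) 0 with h | h
  · rw [max_eq_left h]
    exact (min_le_left _ _).trans (by positivity)
  · refine (min_le_right _ _).trans ?_
    have h1 : d y x ≤ 1 / C := by
      rw [le_div_iff₀ hC]
      linarith [hf x]
    linarith [(abs_sub_le_iff.1 (hg y x)).1, hgF x hx]

end LipUnit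

/-! ### Weak* null sequences of uniform measures, by Baire category. -/

section Sequences

variable {X : Type*} [UniformSpace X]

/-- An element of `LipUnit d` as an element of `U_b(X)`. -/
def LipUnit.toUb {d : X → X → ℝ} (hd : IsUCP d) (f : LipUnit d) : Ub X :=
  Ub.mk f.1 1 (LipUnit.lipB f.2).1 (hd.uniformContinuous f.2.2)

theorem UMeas.continuous_LipUnit {μ : Meas X} (hμ : μ ∈ UMeas X) {d : X → X → ℝ}
    (hd : IsUCP d) : Continuous fun f : LipUnit d => μ (LipUnit.toUb hd f) :=
  continuous_iff_continuousAt.2 fun f₀ => UMeas.tendsto hμ hd zero_le_one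
    (Eventually.of_forall fun f => LipUnit.lipB f.2) (LipUnit.lipB f₀.2) fun x =>
      ((continuous_apply x).comp continuous_subtype_val).tendsto f₀

theorem hump_mem {d : X → X → ℝ} (hd : IsUCP d) {f : X → ℝ} (hf : f ∈ LipUnit d)
    {F : Finset X} (hF : F.Nonempty) : hump d f F hF ∈ LipUnit d := by
  refine ⟨fun y => ⟨le_sup_left, max_le zero_le_one (Finset.sup'_le _ _ fun x _ => ?_)⟩,
    fun y z => ?_⟩
  · linarith [(hf.1 x).2, hd.nonneg y x]
  · refine (abs_max_sub_max_le_max _ _ _ _).trans ?_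
    rw [sub_self, abs_zero]
    refine max_le (hd.nonneg y z) (abs_sup'_sub_sup'_le _ fun x _ => abs_sub_le_iff.2 ⟨?_, ?_⟩)
    · linarith [hd.triangle z y x, hd.symm y z]
    · linarith [hd.triangle y z x]

theorem hump_of_mem {d : X → X → ℝ} (hd : IsUCP d) {f : X → ℝ} (hf : f ∈ LipUnit d)
    {F : Finset X} (hF : F.Nonempty) {y : X} (hy : y ∈ F) : hump d f F hF y = f y := by
  refine le_antisymm (max_le (hf.1 y).1 (Finset.sup'_le _ _ fun x _ => ?_)) (le_max_of_le_right ?_)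
  · linarith [(abs_sub_le_iff.1 (hf.2 y x)).2]
  · refine le_trans ?_ (Finset.le_sup' _ hy)
    simp [hd.self]

theorem tendsto_zero_of_LipUnit (x₀ : X) {L : ℕ → Meas X} (hL : ∀ n, L n ∈ UMeas X)
    {K : ℝ} (hK : ∀ n, ‖L n‖ ≤ K) (hlim : ∀ f, Tendsto (fun n => L n f) atTop (𝓝 0))
    {d : X → X → ℝ} (hd : IsUCP d) {g : ℕ → Ub X}
    (hg : ∀ n, (fun x => (g n).1 x) ∈ LipUnit d)
    (h : ∀ x, Tendsto (fun n => (g n).1 x) atTop (𝓝 0)) :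
    Tendsto (fun n => L n (g n)) atTop (𝓝 0) := by
  classical
  rw [Metric.tendsto_nhds]
  intro ε hε
  have hK0 : 0 ≤ K := (norm_nonneg _).trans (hK 0)
  -- The pseudometric is steepened so that humps become narrow: `C` and `η` are chosen so that `K *
  -- (η + 1 / C) ≤ ε / 2`.
  set C : ℝ := 1 + 4 * K / ε with hCdef
  have hC1 : 1 ≤ C := le_add_of_nonneg_right (by positivity)
  have hC0 : 0 < C := by positivity
  have hKC : K * (1 / C) ≤ ε / 4 := by
    rw [mul_one_div, div_le_iff₀ hC0, hCdef]
    have : ε / 4 * (1 + 4 * K / ε) = ε / 4 + K := by field_simp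
    rw [this]; linarith
  set η : ℝ := ε / (4 * (K + 1)) with hηdef
  have hη0 : 0 < η := by positivity
  have hKη : K * η ≤ ε / 4 := by
    have : (K + 1) * η = ε / 4 := by rw [hηdef]; field_simp
    nlinarith
  set e : X → X → ℝ := fun x y => C * d x y with he
  have hde : IsUCP e := hd.const_mul hC0.le
  have hge : ∀ n, (fun x => (g n).1 x) ∈ LipUnit e := fun n =>
    ⟨(hg n).1, fun x y => ((hg n).2 x y).trans (le_mul_of_one_le_left (hd.nonneg x y) hC1)⟩
  have : CompactSpace (LipUnit e) := isCompact_iff_compactSpace.1 (isCompact_LipUnit e)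
  have : Nonempty (LipUnit e) := ⟨⟨_, hge 0⟩⟩
  let A : ℕ → Set (LipUnit e) := fun N => {f | ∀ k ≥ N, |L k (LipUnit.toUb hde f)| ≤ ε / 8}
  have hAc : ∀ N, IsClosed (A N) := fun N => by
    simp only [A, ofPred_forall]
    exact isClosed_iInter fun k => isClosed_iInter fun _ =>
      isClosed_le (UMeas.continuous_LipUnit (hL k) hde).abs continuous_const
  have hAu : ⋃ N, A N = univ := by
    refine eq_univ_of_forall fun f => mem_iUnion.2 ?_
    obtain ⟨N, hN⟩ := Metric.tendsto_atTop.1 (hlim (LipUnit.toUb hde f)) (ε / 8) (by positivity)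
    exact ⟨N, fun k hk => by simpa using (hN k hk).le⟩
  -- Baire: from `N` on, the functionals are uniformly small on a neighbourhood of some `f₀`, which
  -- is described by finitely many points `I`.
  obtain ⟨N, f₀, hf₀⟩ := nonempty_interior_of_iUnion_of_closed hAc hAu
  obtain ⟨V, hV, hVA⟩ := isOpen_induced_iff.1 (isOpen_interior (s := A N))
  have hf₀V : f₀.1 ∈ V := by rw [← hVA] at hf₀; exact hf₀
  obtain ⟨I, u, hu, hIV⟩ := isOpen_pi_iff.1 hV f₀.1 hf₀V
  have hA : ∀ f : LipUnit e, (∀ x ∈ I, f.1 x ∈ u x) → f ∈ A N := fun f hf =>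
    interior_subset (by rw [← hVA]; exact hIV hf)
  set F : Finset X := insert x₀ I
  have hF : F.Nonempty := Finset.insert_nonempty x₀ I
  -- The hump agrees with `f₀` on `I`, hence lies in the neighbourhood, and so eventually does its
  -- maximum with `g n`, as `g n → 0` on `I`.
  let p : LipUnit e := ⟨hump e f₀.1 F hF, hump_mem hde f₀.2 hF⟩
  have hpF : ∀ x ∈ F, p.1 x = f₀.1 x := fun x hx => hump_of_mem hde f₀.2 hF hx
  have hpA : p ∈ A N := hA p fun x hx => by
    rw [hpF x (Finset.mem_insert_of_mem hx)]; exact (hu x hx).2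
  let q : ℕ → LipUnit e := fun n => ⟨_, LipUnit.max p.2 (hge n)⟩
  have hqA : ∀ᶠ n in atTop, q n ∈ A N := by
    have : ∀ᶠ n in atTop, ∀ x ∈ I, (q n).1 x ∈ u x :=
      (Filter.eventually_all_finset _).2 fun x hx => by
        have hx0 : p.1 x ⊔ 0 = f₀.1 x := by
          rw [max_eq_left (p.2.1 x).1, hpF x (Finset.mem_insert_of_mem hx)]
        have h1 : Tendsto (fun n => (q n).1 x) atTop (𝓝 (f₀.1 x)) := by
          rw [← hx0]
          exact tendsto_const_nhds.max (h x)
        exact h1 ((hu x hx).1.mem_nhds (hu x hx).2)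
    filter_upwards [this] with n hn using hA _ hn
  have hsmall : ∀ᶠ n in atTop, ∀ x ∈ F, (g n).1 x ≤ η :=
    (Filter.eventually_all_finset _).2 fun x _ => by
      filter_upwards [(h x).eventually_lt_const hη0] with n hn using hn.le
  filter_upwards [hqA, hsmall, eventually_ge_atTop N] with n hqn hsn hn
  -- Since `p + g = max p g + min p g`, the remainder `r` is the minimum of hump and `g n`, which is
  -- uniformly small.
  set r : Ub X := LipUnit.toUb hde p + g n - LipUnit.toUb hde (q n) with hr
  have hrn : ‖r‖ ≤ η + 1 / C := by
    refine Ub.norm_le (by positivity) fun y => ?_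
    have h1 : r.1 y = p.1 y ⊓ (g n).1 y := by
      have := min_add_max (p.1 y) ((g n).1 y)
      change p.1 y + (g n).1 y - p.1 y ⊔ (g n).1 y = _
      linarith
    rw [h1, abs_of_nonneg (le_min (p.2.1 y).1 ((hg n).1 y).1)]
    exact hump_min_le hC0 (fun x => (f₀.2.1 x).2) hF hη0.le (hg n).2 hsn y
  have hg_eq : L n (g n) = L n (LipUnit.toUb hde (q n)) - L n (LipUnit.toUb hde p) + L n r := by
    rw [hr, map_sub, map_add]; ring
  have h1 := abs_le.1 (hqn n hn)
  have h2 := abs_le.1 (hpA n hn)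
  have h3 : |L n r| ≤ K * (η + 1 / C) := ((L n).le_opNorm r).trans
    (mul_le_mul (hK n) hrn (norm_nonneg _) hK0)
  have h3' := abs_le.1 h3
  rw [Real.dist_0_eq_abs, hg_eq, abs_lt]
  constructor <;> linarith

/-- Banach–Steinhaus supplies the norm bound; the scaled positive and negative parts of `g n` are
then treated separately. -/
theorem tendsto_zero_of_lipB (x₀ : X) {L : ℕ → Meas X} (hL : ∀ n, L n ∈ UMeas X)
    (hlim : ∀ f, Tendsto (fun n => L n f) atTop (𝓝 0))
    {d : X → X → ℝ} (hd : IsUCP d) {C : ℝ} (hC : 0 ≤ C) {g : ℕ → Ub X}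
    (hg : ∀ n, LipB d C (fun x => (g n).1 x))
    (h : ∀ x, Tendsto (fun n => (g n).1 x) atTop (𝓝 0)) :
    Tendsto (fun n => L n (g n)) atTop (𝓝 0) := by
  obtain ⟨K, hK⟩ := banach_steinhaus (g := L) fun f => by
    obtain ⟨c, hc⟩ := (Metric.isBounded_range_of_tendsto _ (hlim f)).exists_norm_le
    exact ⟨c, fun n => hc _ (mem_range_self n)⟩
  have key : ∀ s : ℝ, |s| = (C + 1)⁻¹ → ∀ n,
      (fun x => (s * (g n).1 x) ⊔ 0) ∈ LipUnit d := by
    intro s hs n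
    have hm := mem_Lip_iff.1 ((hg n).inv_smul_mem hd hC)
    have hb : ∀ x, |s * (g n).1 x| ≤ 1 := fun x => by
      have : |((C + 1)⁻¹ • g n).1 x| ≤ 1 := hm.1 x
      rwa [Ub.smul_apply, abs_mul, abs_of_nonneg (by positivity), ← hs, ← abs_mul] at this
    have hl : ∀ x y, |s * (g n).1 x - s * (g n).1 y| ≤ d x y := fun x y => by
      have : |((C + 1)⁻¹ • g n).1 x - ((C + 1)⁻¹ • g n).1 y| ≤ 1 * d x y := hm.2 x y
      rwa [Ub.smul_apply, Ub.smul_apply, ← mul_sub, abs_mul, abs_of_nonneg (by positivity),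
        ← hs, ← abs_mul, one_mul, mul_sub] at this
    refine ⟨fun x => ⟨le_max_right _ _, max_le ((le_abs_self _).trans (hb x)) zero_le_one⟩,
      fun x y => (abs_max_sub_max_le_max _ _ _ _).trans (max_le (hl x y) ?_)⟩
    simpa using hd.nonneg x y
  have key2 : ∀ (s : ℝ) (hs : |s| = (C + 1)⁻¹),
      Tendsto (fun n => L n (LipUnit.toUb hd ⟨_, key s hs n⟩)) atTop (𝓝 0) := fun s hs =>
    tendsto_zero_of_LipUnit x₀ hL hK hlim hd (key s hs) fun x => by
      have := ((h x).const_mul s).max (tendsto_const_nhds (x := (0 : ℝ)))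
      rwa [mul_zero, max_self] at this
  have hC1 : 0 < C + 1 := by positivity
  have hs1 : |(C + 1)⁻¹| = (C + 1)⁻¹ := abs_of_pos (by positivity)
  have hs2 : |-(C + 1)⁻¹| = (C + 1)⁻¹ := by rw [abs_neg, hs1]
  have h3 := ((key2 _ hs1).sub (key2 _ hs2)).const_mul (C + 1)
  rw [sub_zero, mul_zero] at h3
  refine h3.congr fun n => ?_
  rw [← map_sub, ← smul_eq_mul, ← map_smul]
  congr 1
  refine Ub.ext fun x => ?_
  change (C + 1) * ((C + 1)⁻¹ * (g n).1 x ⊔ 0 - -(C + 1)⁻¹ * (g n).1 x ⊔ 0) = (g n).1 x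
  have h4 : ∀ t : ℝ, t ⊔ 0 - -t ⊔ 0 = t := fun t => by
    rcases le_total t 0 with ht | ht
    · rw [max_eq_right ht, max_eq_left (by linarith)]; ring
    · rw [max_eq_left ht, max_eq_right (by linarith)]; ring
  rw [neg_mul, h4]
  field_simp

end Sequences

/-! ### Slices on the group and continuity of convolution. -/

section Group

variable {G : Type*} [Group G]

/-- The right-invariant pseudometric `sup_y d (x y) (x' y)`, truncated at `2`. -/
def rsup (d : G → G → ℝ) (x x' : G) : ℝ := ⨆ y, min (d (x * y) (x' * y)) 2

theorem le_rsup (d : G → G → ℝ) (x x' y : G) : min (d (x * y) (x' * y)) 2 ≤ rsup d x x' :=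
  le_ciSup (f := fun y => min (d (x * y) (x' * y)) 2)
    ⟨2, by rintro _ ⟨y, rfl⟩; exact min_le_right _ _⟩ y

/-- The truncation in `rsup`, which keeps the supremum finite, costs nothing: two values of `f`
differ by at most `2 * C` anyway. -/
theorem LipB.abs_mul_right_sub_le {d : G → G → ℝ} {C : ℝ} (hC : 0 ≤ C) {f : G → ℝ}
    (hf : LipB d C f) (x x' y : G) : |f (x * y) - f (x' * y)| ≤ C * rsup d x x' := by
  refine le_trans ?_ (mul_le_mul_of_nonneg_left (le_rsup d x x' y) hC)
  rw [mul_min_of_nonneg _ _ hC]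
  refine le_min (hf.2 _ _) ((abs_sub _ _).trans ?_)
  linarith [hf.1 (x * y), hf.1 (x' * y)]

theorem LipB.rtrans {d : G → G → ℝ} {C : ℝ} (hC : 0 ≤ C) {f : G → ℝ}
    (hf : LipB d C f) (y : G) : LipB (rsup d) C (fun x => f (x * y)) :=
  ⟨fun x => hf.1 (x * y), fun x x' => hf.abs_mul_right_sub_le hC x x' y⟩

variable [UniformSpace G] [IsRightUniformGroup G]

theorem IsUCP.rsup {d : G → G → ℝ} (hd : IsUCP d) : IsUCP (rsup d) where
  nonneg x y := Real.iSup_nonneg fun z => le_min (hd.nonneg _ _) zero_le_two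
  self x := by simp [UnifMeas.rsup, hd.self]
  symm x y := by simp only [UnifMeas.rsup, hd.symm]
  triangle x y z := by
    refine ciSup_le fun t => ?_
    have h1 := le_rsup d x y t
    have h2 := le_rsup d y z t
    have h3 := hd.triangle (x * t) (y * t) (z * t)
    have h4 := hd.nonneg (x * t) (y * t)
    have h5 := hd.nonneg (y * t) (z * t)
    refine le_trans ?_ (add_le_add h1 h2)
    rcases le_total (d (x * t) (y * t)) 2 with h | h <;>
    rcases le_total (d (y * t) (z * t)) 2 with h' | h' <;>
    simp only [min_eq_left, min_eq_right, h, h'] <;>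
    first
      | exact (min_le_left _ _).trans h3
      | exact (min_le_right _ _).trans (by linarith)
  unif ε hε := by
    have h := hd.unif (ε / 2) (by positivity)
    -- Right translation leaves the quotient `p.2 * p.1⁻¹` unchanged, so one entourage serves every
    -- `y` in the supremum.
    rw [uniformity_eq_comap_mul_inv_nhds_one G, eventually_comap] at h ⊢
    filter_upwards [h] with z hz p hp
    refine lt_of_le_of_lt (ciSup_le fun y => ?_) (half_lt_self hε)
    refine (min_le_left _ _).trans (hz (p.1 * y, p.2 * y) ?_).le
    rw [← hp]
    simp [mul_assoc]

theorem IsUCP.leftMul {d : G → G → ℝ} (hd : IsUCP d) (x : G) :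
    IsUCP fun y z => d (x * y) (x * z) where
  nonneg _ _ := hd.nonneg _ _
  self _ := hd.self _
  symm _ _ := hd.symm _ _
  triangle _ _ _ := hd.triangle _ _ _
  unif ε hε := (uniformContinuous_leftMul x).eventually (hd.unif ε hε)

theorem LipB.ltrans {d : G → G → ℝ} {C : ℝ} {f : Ub G} (hf : LipB d C (fun x => f.1 x)) (x : G) :
    LipB (fun y z => d (x * y) (x * z)) C (fun y => (ltrans f x).1 y) :=
  ⟨fun y => hf.1 (x * y), fun y z => hf.2 (x * y) (x * z)⟩

/-- The difference of two left translates of `f` has supremum norm at most `C * rsup d x x'`; the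
norm bound on `ν` does the rest. -/
theorem LipB.slice {d : G → G → ℝ} (hd : IsUCP d) {C K : ℝ} (hC : 0 ≤ C) {ν : Meas G}
    (hν : ‖ν‖ ≤ K) {f : Ub G} (hf : LipB d C (fun x => f.1 x)) :
    LipB (rsup d) (K * C) (fun x => (slice ν f).1 x) := by
  have hK : 0 ≤ K := (norm_nonneg ν).trans hν
  have key : ∀ (g : Ub G) (c : ℝ), 0 ≤ c → (∀ y, |g.1 y| ≤ c) → |ν g| ≤ K * c :=
    fun g c hc hg => (ν.le_opNorm g).trans
      (mul_le_mul hν (Ub.norm_le hc hg) (norm_nonneg _) hK)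
  refine ⟨fun x => key _ C hC (hf.ltrans x).1, fun x x' => ?_⟩
  change |ν (UnifMeas.ltrans f x) - ν (UnifMeas.ltrans f x')| ≤ _
  rw [← map_sub, mul_assoc]
  exact key _ _ (mul_nonneg hC (hd.rsup.nonneg x x')) fun y => hf.abs_mul_right_sub_le hC x x' y

theorem norm_conv_le (μ ν : Meas G) : ‖conv μ ν‖ ≤ ‖μ‖ * ‖ν‖ :=
  LinearMap.mkContinuous_norm_le _ (by positivity) _

/-- Uniformity of `ν` makes the slices converge pointwise, and uniformity of `μ` then applies to
them. -/
theorem conv_mem_UMeas {μ ν : Meas G} (hμ : μ ∈ UMeas G) (hν : ν ∈ UMeas G) :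
    conv μ ν ∈ UMeas G :=
  mem_UMeas_of_tendsto fun d hd _ f₀ h =>
    UMeas.tendsto hμ hd.rsup (C := ‖ν‖ * 1) (by positivity)
      (Eventually.of_forall fun f => (mem_Lip_iff.1 f.2).slice hd zero_le_one le_rfl)
      ((mem_Lip_iff.1 f₀.2).slice hd zero_le_one le_rfl) fun x =>
      UMeas.tendsto hν (hd.leftMul x) zero_le_one
        (Eventually.of_forall fun f => (mem_Lip_iff.1 f.2).ltrans x)
        ((mem_Lip_iff.1 f₀.2).ltrans x) fun y => h (x * y)

theorem conv_mem_MeasPos {μ ν : Meas G} (hμ : μ ∈ MeasPos G) (hν : ν ∈ MeasPos G) :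
    conv μ ν ∈ MeasPos G :=
  fun _ hf => hμ _ fun x => hν _ fun y => hf (x * y)

theorem continuousWithinAt_conv_UEB {B : Set (Meas G)} (hB : Bornology.IsBounded B)
    {μ₀ ν₀ : Meas G} (hμ₀ : μ₀ ∈ UMeas G) (hν₀ : ν₀ ∈ B) :
    ContinuousWithinAt
      (fun p : MeasUEB G × MeasUEB G => toUEB (conv (toUEB.symm p.1) (toUEB.symm p.2)))
      (univ ×ˢ (toUEB '' B)) (toUEB μ₀, toUEB ν₀) := by
  obtain ⟨K, hK⟩ := hB.exists_norm_le
  have hK0 : 0 ≤ K := (norm_nonneg _).trans (hK ν₀ hν₀)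
  set l := 𝓝[univ ×ˢ (toUEB '' B)] ((toUEB μ₀, toUEB ν₀) : MeasUEB G × MeasUEB G)
  refine tendsto_toUEB_iff.2 fun d hd => ?_
  set m := l ×ˢ 𝓟 (Lip d)
  have hl : Tendsto (fun q : (MeasUEB G × MeasUEB G) × Ub G => q.1) m l := tendsto_fst
  have hl' : Tendsto (fun p : MeasUEB G × MeasUEB G => p) l (𝓝 (toUEB μ₀, toUEB ν₀)) :=
    nhdsWithin_le_nhds
  have hlμ := ((continuous_fst.tendsto _).comp hl').comp hl
  have hlν := ((continuous_snd.tendsto _).comp hl').comp hl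
  have hf : ∀ᶠ q in m, LipB d 1 (fun x => q.2.1 x) := by
    have : ∀ᶠ q in m, q.2 ∈ Lip d := tendsto_snd.eventually (mem_principal_self _)
    filter_upwards [this] with q hq using mem_Lip_iff.1 hq
  have hν : ∀ᶠ q in m, ‖toUEB.symm q.1.2‖ ≤ K := by
    have : ∀ᶠ q in m, q.1 ∈ univ ×ˢ (toUEB '' B) := hl.eventually eventually_mem_nhdsWithin
    filter_upwards [this] with q hq
    obtain ⟨ν, hν, hq2⟩ := hq.2
    rw [← hq2, Equiv.symm_apply_apply]
    exact hK ν hν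
  have hs : ∀ᶠ q in m, LipB (rsup d) (K * 1) (fun x => (slice (toUEB.symm q.1.2) q.2).1 x) := by
    filter_upwards [hf, hν] with q hq1 hq2 using hq1.slice hd zero_le_one hq2
  have h1 := tendsto_toUEB_lipB tendsto_id hd.rsup (by positivity) hlμ hs
  -- The test function `q.2` varies without converging, so uniformity of `μ₀` is applied to
  -- differences of slices. These are pointwise null by UEB convergence of `ν` on left translates.
  have h2 : Tendsto (fun q => μ₀ (slice (toUEB.symm q.1.2) q.2 - slice ν₀ q.2)) m (𝓝 (μ₀ 0)) := by
    refine UMeas.tendsto hμ₀ hd.rsup (C := K * 1 + K * 1) (by positivity) ?_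
      ⟨fun x => by simp; positivity, fun x y => ?_⟩ fun x => ?_
    · filter_upwards [hf, hs] with q hq1 hq2
        using hq2.sub (hq1.slice hd zero_le_one (hK ν₀ hν₀))
    · simpa using mul_nonneg (by positivity) (hd.rsup.nonneg x y)
    · refine tendsto_toUEB_lipB tendsto_id (hd.leftMul x) zero_le_one hlν
        (g := fun q => ltrans q.2 x) ?_
      filter_upwards [hf] with q hq using hq.ltrans x
  have h3 := h1.add h2
  rw [map_zero, add_zero] at h3
  refine h3.congr fun q => ?_
  simp only [Function.comp_apply, id, Equiv.symm_apply_apply, _root_.sub_apply,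
    conv_apply, map_sub]
  ring

/-- Weak* convergence of convolutions, reduced to convergence along pointwise null nets of bounded
equi-Lipschitz functions. -/
theorem tendsto_conv {ι : Type*} {l : Filter ι} {μ ν : ι → Meas G} {μ₀ ν₀ : Meas G}
    (hμ : ∀ f, Tendsto (fun i => μ i f) l (𝓝 (μ₀ f)))
    (hν : ∀ f, Tendsto (fun i => ν i f) l (𝓝 (ν₀ f))) {K : ℝ} (hK : ∀ᶠ i in l, ‖ν i‖ ≤ K)
    (key : ∀ (d : G → G → ℝ) (C : ℝ) (g : ι → Ub G), IsUCP d → 0 ≤ C →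
      (∀ᶠ i in l, LipB d C (fun x => (g i).1 x)) →
      (∀ x, Tendsto (fun i => (g i).1 x) l (𝓝 0)) → Tendsto (fun i => μ i (g i)) l (𝓝 0))
    (f : Ub G) : Tendsto (fun i => conv (μ i) (ν i) f) l (𝓝 (conv μ₀ ν₀ f)) := by
  obtain ⟨d, C, hd, hC, hf⟩ := f.exists_lipB
  have h1 : Tendsto (fun i => μ i (slice (ν i) f - slice ν₀ f)) l (𝓝 0) := by
    refine key (rsup d) (|K| * C + ‖ν₀‖ * C) _ hd.rsup (by positivity) ?_ fun x => ?_
    · filter_upwards [hK] with i hi using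
        (hf.slice hd hC (hi.trans (le_abs_self K))).sub (hf.slice hd hC le_rfl)
    · simpa using (hν (ltrans f x)).sub_const (ν₀ (ltrans f x))
  have h2 := h1.add (hμ (slice ν₀ f))
  rw [zero_add] at h2
  refine h2.congr fun i => ?_
  rw [map_sub, conv_apply]
  ring

theorem tendsto_conv_seq {μ ν : ℕ → Meas G} {μ₀ ν₀ : Meas G} (hμU : ∀ n, μ n ∈ UMeas G)
    (hμ₀ : μ₀ ∈ UMeas G) (hμ : ∀ f, Tendsto (fun n => μ n f) atTop (𝓝 (μ₀ f)))
    (hν : ∀ f, Tendsto (fun n => ν n f) atTop (𝓝 (ν₀ f))) (f : Ub G) :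
    Tendsto (fun n => conv (μ n) (ν n) f) atTop (𝓝 (conv μ₀ ν₀ f)) := by
  obtain ⟨K, hK⟩ := banach_steinhaus (g := ν) fun f => by
    obtain ⟨c, hc⟩ := (Metric.isBounded_range_of_tendsto _ (hν f)).exists_norm_le
    exact ⟨c, fun n => hc _ (mem_range_self n)⟩
  refine tendsto_conv hμ hν (Eventually.of_forall hK) (fun d C g hd hC hg h => ?_) f
  obtain ⟨N, hN⟩ := eventually_atTop.1 hg
  -- The Lipschitz bound holds from `N` on only, while `tendsto_zero_of_lipB` requires it for every
  -- index.
  refine (tendsto_add_atTop_iff_nat N).1 ?_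
  have hg' : ∀ n, LipB d C (fun x => (g (n + N)).1 x) := fun n => hN _ (Nat.le_add_left N n)
  have h' : ∀ x, Tendsto (fun n => (g (n + N)).1 x) atTop (𝓝 0) := fun x =>
    (tendsto_add_atTop_iff_nat N).2 (h x)
  have h1 := tendsto_zero_of_lipB 1 (L := fun n => μ (n + N) - μ₀)
    (fun n => UMeas.sub_mem (hμU _) hμ₀)
    (fun f => by
      simpa using ((tendsto_add_atTop_iff_nat N).2 (hμ f)).sub_const (μ₀ f)) hd hC hg' h'
  have h2 : Tendsto (fun n => μ₀ (g (n + N))) atTop (𝓝 (μ₀ 0)) :=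
    UMeas.tendsto hμ₀ hd hC (Eventually.of_forall hg')
      ⟨by simpa using hC, fun x y => by simpa using mul_nonneg hC (hd.nonneg x y)⟩ h'
  simpa using h1.add h2

/-- A positive `ν` has norm at most `ν Ub.one`, so weak* convergence alone bounds the norms
eventually. -/
theorem continuousWithinAt_conv_MeasPos {μ₀ ν₀ : Meas G} (hμ₀ : μ₀ ∈ UMeas G)
    (hμ₀' : μ₀ ∈ MeasPos G) :
    ContinuousWithinAt
      (fun p : MeasW G × MeasW G => toW (conv (toW.symm p.1) (toW.symm p.2)))
      ((toW '' MeasPos G) ×ˢ (toW '' MeasPos G)) (toW μ₀, toW ν₀) := by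
  classical
  set S : Set (MeasW G × MeasW G) := (toW '' MeasPos G) ×ˢ (toW '' MeasPos G)
  have hid : Tendsto (fun p : MeasW G × MeasW G => p) (𝓝[S] (toW μ₀, toW ν₀))
    (𝓝 (toW μ₀, toW ν₀)) := nhdsWithin_le_nhds
  have hμ := tendsto_toW_iff.1 ((continuous_fst.tendsto _).comp hid)
  have hν := tendsto_toW_iff.1 ((continuous_snd.tendsto _).comp hid)
  have hmem : ∀ᶠ p in 𝓝[S] (toW μ₀, toW ν₀),
      toW.symm p.1 ∈ MeasPos G ∧ toW.symm p.2 ∈ MeasPos G := by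
    filter_upwards [eventually_mem_nhdsWithin] with p hp
    obtain ⟨⟨a, ha, ha'⟩, ⟨b, hb, hb'⟩⟩ := hp
    rw [← ha', ← hb', Equiv.symm_apply_apply, Equiv.symm_apply_apply]
    exact ⟨ha, hb⟩
  refine tendsto_toW_iff.2 fun f => ?_
  refine tendsto_conv hμ hν (K := ν₀ Ub.one + 1) ?_ (fun d C g hd _ hg h =>
    MeasPos.tendsto_zero 1 hμ₀ (hmem.mono fun _ hp => hp.1) hμ₀' hμ hd hg h) f
  filter_upwards [hmem, (hν Ub.one).eventually_lt_const (lt_add_one (ν₀ Ub.one))] with p hp hp'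
  exact (MeasPos.norm_le hp.2).trans hp'.le

/-! ### Fubini identity and weak* continuity in the right factor. -/

theorem uniformContinuous_rightMul (y : G) : UniformContinuous (fun x : G => x * y) := by
  rw [UniformContinuous]
  conv => rhs; rw [uniformity_eq_comap_mul_inv_nhds_one G]
  rw [tendsto_comap_iff, uniformity_eq_comap_mul_inv_nhds_one G]
  refine tendsto_comap.congr fun p => ?_
  simp [mul_assoc]

/-- For `f ∈ U_b(G)` and `y ∈ G`, the function `x ↦ f (x * y)`, as an element of `U_b(G)`. -/
def rtrans (f : Ub G) (y : G) : Ub G :=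
  Ub.mk (fun x => f.1 (x * y)) ‖f‖ (fun _ => f.abs_apply_le _)
    (UniformContinuous.comp f.2 (uniformContinuous_rightMul y))

/-- Along `𝓤 G`, differences of right translates of `f` are equi-Lipschitz for `rsup d` and
pointwise null, so uniformity of `μ` applies. -/
theorem uniformContinuous_apply_rtrans {μ : Meas G} (hμ : μ ∈ UMeas G) (f : Ub G) :
    UniformContinuous fun y => μ (rtrans f y) := by
  obtain ⟨d, C, hd, hC, hf⟩ := f.exists_lipB
  have h : Tendsto (fun p : G × G => μ (rtrans f p.2 - rtrans f p.1)) (𝓤 G) (𝓝 (μ 0)) := by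
    refine UMeas.tendsto hμ hd.rsup (C := C + C) (by positivity)
      (Eventually.of_forall fun p => (hf.rtrans hC p.2).sub (hf.rtrans hC p.1))
      ⟨by simpa using add_nonneg hC hC, fun x y => by
        simpa using mul_nonneg (add_nonneg hC hC) (hd.rsup.nonneg x y)⟩ fun x => ?_
    have hu : UniformContinuous fun y => f.1 (x * y) :=
      UniformContinuous.comp f.2 (uniformContinuous_leftMul x)
    rw [UniformContinuous, uniformity_eq_comap_nhds_zero ℝ, tendsto_comap_iff] at hu
    exact hu
  rw [UniformContinuous, uniformity_eq_comap_nhds_zero ℝ, tendsto_comap_iff]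
  rw [map_zero] at h
  exact h.congr fun p => map_sub μ _ _

/-- For a uniform measure `μ` and `f ∈ U_b(G)`, the function `y ↦ μ (x ↦ f (x * y))`. -/
def fiber {μ : Meas G} (hμ : μ ∈ UMeas G) (f : Ub G) : Ub G :=
  Ub.mk (fun y => μ (rtrans f y)) (‖μ‖ * ‖f‖)
    (fun _ => (μ.le_opNorm _).trans (mul_le_mul_of_nonneg_left
      (Ub.norm_le (norm_nonneg f) fun _ => f.abs_apply_le _) (norm_nonneg μ)))
    (uniformContinuous_apply_rtrans hμ f)

theorem conv_apply_eq_fiber_of_mem_span {μ : Meas G} (hμ : μ ∈ UMeas G) (f : Ub G) {ξ : Meas G}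
    (hξ : ξ ∈ Submodule.span ℝ (range (dirac (X := G)))) : conv μ ξ f = ξ (fiber hμ f) := by
  induction hξ using Submodule.span_induction with
  | mem ξ h =>
    obtain ⟨_, rfl⟩ := h
    rfl
  | zero => exact (congrArg μ (show slice 0 f = 0 from rfl)).trans (map_zero μ)
  | add ξ ξ' _ _ h h' =>
    have : slice (ξ + ξ') f = slice ξ f + slice ξ' f := Ub.ext fun _ => rfl
    rw [conv_apply, this, map_add, _root_.add_apply, ← h, ← h']
    rfl
  | smul c ξ _ h =>
    have : slice (c • ξ) f = c • slice ξ f := Ub.ext fun _ => rfl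
    rw [conv_apply, this, map_smul, _root_.smul_apply, ← h]
    rfl

/-- The Fubini identity for convolutions whose left factor is a uniform measure. -/
theorem conv_apply_eq_fiber {μ : Meas G} (hμ : μ ∈ UMeas G) (ν : Meas G) (f : Ub G) :
    conv μ ν f = ν (fiber hμ f) := by
  obtain ⟨d, C, hd, hC, hf⟩ := f.exists_lipB
  set D := {ξ : MeasW G |
      toW.symm ξ ∈ Submodule.span ℝ (range (dirac (X := G))) ∧ ‖toW.symm ξ‖ ≤ ‖ν‖}
  have hne : (𝓝[D] toW ν).NeBot := mem_closure_iff_nhdsWithin_neBot.1 (mem_closure_molecular ν)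
  have hD : ∀ᶠ ξ in 𝓝[D] toW ν, ξ ∈ D := eventually_mem_nhdsWithin
  have hlim := tendsto_toW_iff.1 (show Tendsto (fun ξ => ξ) (𝓝[D] toW ν) (𝓝 (toW ν)) from
    nhdsWithin_le_nhds)
  -- The norm bound in `D` gives all these slices one Lipschitz constant, which lets `μ` pass to the
  -- limit.
  have h1 : Tendsto (fun ξ => μ (slice (toW.symm ξ) f)) (𝓝[D] toW ν) (𝓝 (μ (slice ν f))) := by
    refine UMeas.tendsto hμ hd.rsup (C := ‖ν‖ * C) (by positivity) ?_
      (hf.slice hd hC le_rfl) fun x => hlim (ltrans f x)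
    filter_upwards [hD] with ξ hξ using hf.slice hd hC hξ.2
  refine tendsto_nhds_unique h1 ((hlim (fiber hμ f)).congr' ?_)
  filter_upwards [hD] with ξ hξ
  exact (conv_apply_eq_fiber_of_mem_span hμ f hξ.1).symm

theorem continuous_conv_right {μ : Meas G} (hμ : μ ∈ UMeas G) :
    Continuous fun ν : MeasW G => toW (conv μ (toW.symm ν)) := by
  refine continuous_iff_continuousAt.2 fun ν₀ => tendsto_toW_iff.2 fun f => ?_
  simp only [Equiv.symm_apply_apply, conv_apply_eq_fiber hμ]
  exact tendsto_toW_iff.1 tendsto_id (fiber hμ f)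

end Group

end UnifMeas

end

theorem mainTheorem7 {G : Type*} [Group G] [UniformSpace G] [IsRightUniformGroup G] :
    (∀ μ ν : Meas G, ‖conv μ ν‖ ≤ ‖μ‖ * ‖ν‖) ∧
    (∀ B : Set (Meas G), Bornology.IsBounded B → ∀ μ₀ ∈ UMeas G, ∀ ν₀ ∈ B,
      ContinuousWithinAt
        (fun p : MeasUEB G × MeasUEB G => toUEB (conv (toUEB.symm p.1) (toUEB.symm p.2)))
        (univ ×ˢ (toUEB '' B)) (toUEB μ₀, toUEB ν₀)) ∧
    ((∀ μ ∈ UMeas G, ∀ ν ∈ UMeas G, conv μ ν ∈ UMeas G) ∧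
      ∀ μ ν : ℕ → Meas G, (∀ n, μ n ∈ UMeas G) → (∀ n, ν n ∈ UMeas G) →
        ∀ μ₀ ∈ UMeas G, ∀ ν₀ ∈ UMeas G,
          Tendsto (fun n => toW (μ n)) atTop (𝓝 (toW μ₀)) →
          Tendsto (fun n => toW (ν n)) atTop (𝓝 (toW ν₀)) →
          Tendsto (fun n => toW (conv (μ n) (ν n))) atTop (𝓝 (toW (conv μ₀ ν₀)))) ∧
    ((∀ μ ∈ MeasPos G, ∀ ν ∈ MeasPos G, conv μ ν ∈ MeasPos G) ∧
      ∀ μ₀ ∈ UMeas G ∩ MeasPos G, ∀ ν₀ ∈ MeasPos G,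
        ContinuousWithinAt
          (fun p : MeasW G × MeasW G => toW (conv (toW.symm p.1) (toW.symm p.2)))
          ((toW '' MeasPos G) ×ˢ (toW '' MeasPos G)) (toW μ₀, toW ν₀)) ∧
    (∀ μ ∈ UMeas G, Continuous (fun ν : MeasW G => toW (conv μ (toW.symm ν)))) := by
  refine ⟨norm_conv_le, fun B hB μ₀ hμ₀ ν₀ hν₀ => continuousWithinAt_conv_UEB hB hμ₀ hν₀,
    ⟨fun μ hμ ν hν => conv_mem_UMeas hμ hν, fun μ ν hμ _ μ₀ hμ₀ ν₀ _ hlμ hlν => ?_⟩,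
    ⟨fun μ hμ ν hν => conv_mem_MeasPos hμ hν, fun μ₀ hμ₀ ν₀ _ =>
      continuousWithinAt_conv_MeasPos hμ₀.1 hμ₀.2⟩,
    fun μ hμ => continuous_conv_right hμ⟩
  exact tendsto_toW_iff.2 (tendsto_conv_seq hμ hμ₀ (tendsto_toW_iff.1 hlμ) (tendsto_toW_iff.1 hlν))
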